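/- Let $n\ge 1$ and $d\ge 0$, let $C=\langle a_1,\dots,a_n\rangle$ and $D=\langle a_{n+1},\dots,a_{n+d}\rangle$ be free groups of ranks $n$ and $d$, and let $A=C*D$, a free group on $a_1,\dots,a_{n+d}$, with projection $\pi:A\to C$ that kills $D$. Let $K$ be a nontrivial finitely generated group and let $B=\bigoplus_{\omega\in C}K_\omega$ be the group of finitely supported families $(x_\omega)_{\omega\in C}$ of elements of $K$. Let $a\in A$ act on $B$ by left multiplication of the indices by $\pi(a)$, that is $(\varphi_a x)_\omega=x_{\pi(a)^{-1}\omega}$, and let $G=B\rtimes_\varphi A=K\,\mathrm{wr}_C\,A$. Let $T$ be the Cayley tree of $A$ with respect to $\{a_1,\dots,a_{n+d}\}$, with its path metric in which all edges have length $1$, and let $\rho:G\to\mathrm{Isom}(T)$ be the projection $G\to A$ followed by the natural action of $A$ on $T$. The boundary $\partial T$ is the set of classes $\tau(\infty)$ of geodesic rays $\tau:[0,\infty)\to T$, two rays being equivalent if they stay at bounded distance. The horoballs are $HB_t(\tau)=\bigcup_{l\ge\max\{0,t\}}\overline{\mathrm{Ball}}_{\,l-t}(\tau(l))$, $t\in\mathbb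 R$. Choose a connected one-dimensional CW complex $Y$ with a free action of $G$ that permutes the cells, with finitely many orbits of cells (equivalently, the $1$-skeleton of the universal cover of a $K(G,1)$-complex with finite $1$-skeleton), and a continuous $G$-map $h:Y\to T$; let $Y_{(\tau,t)}$ be the largest subcomplex of $Y$ contained in $h^{-1}(HB_t(\tau))$. Then $\tau(\infty)\in\Sigma^1(\rho)$ means that there is $\lambda:\mathbb R\to[0,\infty)$ with $t-\lambda(t)\to\infty$ as $t\to\infty$ such that, for every $t\in\mathbb R$, any two points of $Y_{(\tau,t)}$ can be joined by a path in $Y_{(\tau,t-\lambda(t))}$; this property does not depend on the choice of $Y$, $h$ and the representative $\tau$. For every geodesic ray $\tau$ in $T$, the endpoint $\tau(\infty)$ lies in $\Sigma^1(\rho)$ if and only if $\tau$ contains infinitely many letters from $D$, that is, $\tau$ runs (forwards or backwards) through infinitely many edges labelled by one of $a_{n+1},\dots,a_{n+d}$. -/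

import Mathlib

open scoped NNReal unitInterval
open Filter

universe u

namespace SigmaInv

/-! ### Rays, the boundary at infinity and horoballs -/

/-- A geodesic ray in a metric space. -/
structure GeodesicRay (M : Type*) [MetricSpace M] where
  toFun : ℝ≥0 → M
  isometry : Isometry toFun

/-- Two rays are asymptotic if they stay at bounded distance. -/
def raySetoid (M : Type*) [MetricSpace M] : Setoid (GeodesicRay M) where
  r τ τ' := ∃ R : ℝ, ∀ t, dist (τ.toFun t) (τ'.toFun t) ≤ R
  iseqv := by
    refine ⟨fun τ => ⟨0, fun t => by simp⟩, ?_, ?_⟩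
    · rintro τ τ' ⟨R, hR⟩
      exact ⟨R, fun t => by rw [dist_comm]; exact hR t⟩
    · rintro τ τ' υ ⟨R, hR⟩ ⟨R', hR'⟩
      exact ⟨R + R', fun t => (dist_triangle _ _ _).trans (add_le_add (hR t) (hR' t))⟩

/-- The boundary at infinity `∂M`: asymptotic classes of geodesic rays. -/
def Boundary (M : Type*) [MetricSpace M] : Type _ := Quotient (raySetoid M)

/-- The endpoint `τ(∞)` of a ray. -/
def GeodesicRay.endpoint {M : Type*} [MetricSpace M] (τ : GeodesicRay M) : Boundary M :=
  Quotient.mk (raySetoid M) τ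

/-- The horoball `HB_k(τ)`, the nested union of the closed balls of radius `l - k` about `τ(l)`,
over `l ≥ max 0 k`. It shrinks towards `τ(∞)` as `k` increases. -/
def horoball {M : Type*} [MetricSpace M] (τ : GeodesicRay M) (k : ℝ) : Set M :=
  {x | ∃ l : ℝ≥0, k ≤ l ∧ dist x (τ.toFun l) ≤ l - k}

/-! ### Free cocompact connected one-dimensional `G`-complexes -/

/-- A `G`-graph with oriented edges (loops and multiple edges allowed, no inversions). -/
structure GGraph (G : Type u) [Group G] where
  V : Type u
  E : Type u
  src : E → V
  tgt : E → V
  actV : MulAction G V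
  actE : MulAction G E
  src_smul : ∀ (g : G) (e : E), src (g • e) = g • src e
  tgt_smul : ∀ (g : G) (e : E), tgt (g • e) = g • tgt e

attribute [instance] GGraph.actV GGraph.actE

namespace GGraph

variable {G : Type u} [Group G] (Γ : GGraph G)

/-- The ends of the interval of an edge are glued to the two endpoints of the edge. -/
inductive Glue : Γ.V ⊕ Γ.E × I → Γ.V ⊕ Γ.E × I → Prop
  | src (e : Γ.E) : Glue (Sum.inr (e, 0)) (Sum.inl (Γ.src e))
  | tgt (e : Γ.E) : Glue (Sum.inr (e, 1)) (Sum.inl (Γ.tgt e))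

/-- The geometric realization, a one-dimensional CW complex. -/
def Realization : Type u := Quot Γ.Glue

/-- The `0`-cells. -/
def vert (v : Γ.V) : Γ.Realization := Quot.mk _ (Sum.inl v)

/-- The characteristic maps of the closed `1`-cells. -/
def edge (e : Γ.E) (s : I) : Γ.Realization := Quot.mk _ (Sum.inr (e, s))

/-- The weak topology: a set is open iff its preimage in the interval of every edge is open. -/
instance : TopologicalSpace Γ.Realization :=
  ⨆ e : Γ.E, TopologicalSpace.coinduced (Γ.edge e) inferInstance

/-- A subcomplex: a union of vertices and closed edges which contains the endpoints of each of
its edges. -/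
def IsSubcomplex (S : Set Γ.Realization) : Prop :=
  ∃ (V' : Set Γ.V) (E' : Set Γ.E), (∀ e ∈ E', Γ.src e ∈ V' ∧ Γ.tgt e ∈ V') ∧
    S = Γ.vert '' V' ∪ ⋃ e ∈ E', Set.range (Γ.edge e)

/-- The largest subcomplex contained in `U`. -/
def largestSubcomplex (U : Set Γ.Realization) : Set Γ.Realization :=
  ⋃₀ {S | Γ.IsSubcomplex S ∧ S ⊆ U}

/-- The `1`-skeleta of universal covers of `K(G,1)`-complexes with cocompact `1`-skeleton:
connected graphs with a free action of `G` and finitely many orbits of cells. -/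
structure IsFreeCocompactConnected : Prop where
  free : ∀ (g : G) (v : Γ.V), g • v = v → g = 1
  finite_V : Finite (MulAction.orbitRel.Quotient G Γ.V)
  finite_E : Finite (MulAction.orbitRel.Quotient G Γ.E)
  connected : PathConnectedSpace Γ.Realization

variable {M : Type*} [MetricSpace M]

/-- A continuous `G`-map from the realization to `M`, where `G` acts on `M` through `ρ`. -/
structure IsControlMap (ρ : G →* (M ≃ᵢ M)) (h : Γ.Realization → M) : Prop where
  continuous : Continuous h
  map_vert : ∀ (g : G) (v : Γ.V), h (Γ.vert (g • v)) = ρ g (h (Γ.vert v))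
  map_edge : ∀ (g : G) (e : Γ.E) (s : I), h (Γ.edge (g • e) s) = ρ g (h (Γ.edge e s))

/-- `h` is controlled connected over `τ(∞)`. -/
def ControlledConnected (h : Γ.Realization → M) (τ : GeodesicRay M) : Prop :=
  ∃ lag : ℝ → ℝ≥0,
    (∀ t : ℝ, ∀ x ∈ Γ.largestSubcomplex (h ⁻¹' horoball τ t),
      ∀ y ∈ Γ.largestSubcomplex (h ⁻¹' horoball τ t),
        JoinedIn (Γ.largestSubcomplex (h ⁻¹' horoball τ (t - lag t))) x y) ∧
    Tendsto (fun t : ℝ => t - lag t) atTop atTop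

end GGraph

/-- The invariant `Σ¹(ρ)` of an action `ρ` by isometries of `G` on `M`: the set of endpoints over
which `ρ` is controlled connected. -/
def Sigma1 {G : Type u} [Group G] {M : Type*} [MetricSpace M] (ρ : G →* (M ≃ᵢ M)) :
    Set (Boundary M) :=
  {e | ∃ (τ : GeodesicRay M) (Γ : GGraph G) (h : Γ.Realization → M), τ.endpoint = e ∧
    Γ.IsFreeCocompactConnected ∧ Γ.IsControlMap ρ h ∧ Γ.ControlledConnected h τ}

/-! ### The Cayley tree of a free group as a metric space -/

section Tree

variable (ι : Type) [DecidableEq ι]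

/-- The point at position `pos ∈ [0,1]` on the edge from `base` to `base * gen`. -/
@[ext] structure EdgePoint where
  base : FreeGroup ι
  gen : ι
  pos : I

variable {ι}

/-- The word metric `|a⁻¹ b|` of the free group. -/
def wordDist (a b : FreeGroup ι) : ℝ := (FreeGroup.norm (a⁻¹ * b) : ℝ)

namespace EdgePoint

/-- The distance from a point of an edge to a vertex `v`. -/
def toVertex (p : EdgePoint ι) (v : FreeGroup ι) : ℝ :=
  min (p.pos + wordDist p.base v) (1 - p.pos + wordDist (p.base * FreeGroup.of p.gen) v)

/-- The path metric with edges of length `1`. -/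
def pathDist (p q : EdgePoint ι) : ℝ :=
  if p.base = q.base ∧ p.gen = q.gen then |(p.pos : ℝ) - q.pos|
  else min (p.toVertex q.base + q.pos)
    (p.toVertex (q.base * FreeGroup.of q.gen) + (1 - q.pos))

end EdgePoint

theorem wordDist_self (a : FreeGroup ι) : wordDist a a = 0 := by simp [wordDist]

theorem wordDist_comm (a b : FreeGroup ι) : wordDist a b = wordDist b a := by
  unfold wordDist
  rw [← FreeGroup.norm_inv_eq]
  simp

theorem wordDist_nonneg (a b : FreeGroup ι) : 0 ≤ wordDist a b := by
  unfold wordDist; positivity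

theorem wordDist_triangle (a b c : FreeGroup ι) :
    wordDist a c ≤ wordDist a b + wordDist b c := by
  unfold wordDist
  have h := FreeGroup.norm_mul_le (a⁻¹ * b) (b⁻¹ * c)
  rw [show a⁻¹ * b * (b⁻¹ * c) = a⁻¹ * c by group] at h
  exact_mod_cast h

theorem wordDist_mul_left (g a b : FreeGroup ι) : wordDist (g * a) (g * b) = wordDist a b := by
  unfold wordDist
  rw [show (g * a)⁻¹ * (g * b) = a⁻¹ * b by group]

theorem wordDist_edge (a : FreeGroup ι) (x : ι) : wordDist a (a * FreeGroup.of x) = 1 := by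
  simp [wordDist]

namespace EdgePoint

theorem pathDist_self (p : EdgePoint ι) : p.pathDist p = 0 := by simp [pathDist]

theorem pathDist_comm (p q : EdgePoint ι) : p.pathDist q = q.pathDist p := by
  unfold pathDist toVertex
  by_cases h : p.base = q.base ∧ p.gen = q.gen
  · rw [if_pos h, if_pos ⟨h.1.symm, h.2.symm⟩, abs_sub_comm]
  · rw [if_neg h, if_neg (fun h' => h ⟨h'.1.symm, h'.2.symm⟩)]
    rw [wordDist_comm q.base, wordDist_comm q.base, wordDist_comm (q.base * _),
      wordDist_comm (q.base * _)]
    grind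

theorem toVertex_le (p : EdgePoint ι) (v w : FreeGroup ι) :
    p.toVertex w ≤ p.toVertex v + wordDist v w := by
  have h1 := wordDist_triangle p.base v w
  have h2 := wordDist_triangle (p.base * FreeGroup.of p.gen) v w
  unfold toVertex
  grind

theorem toVertex_le_pathDist_add (p q : EdgePoint ι) (v : FreeGroup ι) :
    p.toVertex v ≤ p.pathDist q + q.toVertex v := by
  unfold pathDist
  split_ifs with h
  · unfold toVertex
    rw [h.1, h.2]
    grind
  · have h1 := toVertex_le p q.base v
    have h2 := toVertex_le p (q.base * FreeGroup.of q.gen) v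
    have h3 := toVertex_le p q.base (q.base * FreeGroup.of q.gen)
    have h4 := toVertex_le p (q.base * FreeGroup.of q.gen) q.base
    rw [wordDist_comm] at h4
    rw [wordDist_edge] at h3 h4
    have h5 := q.pos.2.1
    have h6 := q.pos.2.2
    rw [show q.toVertex v = min (q.pos + wordDist q.base v)
      (1 - q.pos + wordDist (q.base * FreeGroup.of q.gen) v) from rfl]
    grind

theorem pathDist_triangle (p q r : EdgePoint ι) :
    p.pathDist r ≤ p.pathDist q + q.pathDist r := by
  have h1 := toVertex_le_pathDist_add p q r.base
  have h2 := toVertex_le_pathDist_add p q (r.base * FreeGroup.of r.gen)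
  by_cases hqr : q.base = r.base ∧ q.gen = r.gen
  · by_cases hpr : p.base = r.base ∧ p.gen = r.gen
    · rw [pathDist, pathDist, pathDist, if_pos hpr, if_pos hqr,
        if_pos ⟨hpr.1.trans hqr.1.symm, hpr.2.trans hqr.2.symm⟩]
      exact abs_sub_le _ _ _
    · have hpq : ¬(p.base = q.base ∧ p.gen = q.gen) := fun h =>
        hpr ⟨h.1.trans hqr.1, h.2.trans hqr.2⟩
      rw [pathDist, pathDist, pathDist, if_neg hpr, if_pos hqr, if_neg hpq, hqr.1, hqr.2]
      grind
  · have key : min (p.toVertex r.base + r.pos)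
        (p.toVertex (r.base * FreeGroup.of r.gen) + (1 - r.pos)) ≤
        p.pathDist q + q.pathDist r := by
      rw [pathDist.eq_def q r, if_neg hqr]
      grind
    refine le_trans ?_ key
    by_cases hpr : p.base = r.base ∧ p.gen = r.gen
    · rw [pathDist, if_pos hpr]
      have h5 := p.pos.2
      have h6 := r.pos.2
      unfold toVertex
      rw [hpr.1, hpr.2, wordDist_self, wordDist_self,
        wordDist_comm (r.base * FreeGroup.of r.gen) r.base, wordDist_edge]
      simp only [Set.mem_Icc] at h5 h6
      grind
    · rw [pathDist, if_neg hpr]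

instance : PseudoMetricSpace (EdgePoint ι) where
  dist := pathDist
  dist_self := pathDist_self
  dist_comm := pathDist_comm
  dist_triangle := pathDist_triangle

end EdgePoint

variable (ι) in
/-- The Cayley tree of the free group on `ι`, with its path metric: points of the edges at
distance `0` (endpoints of edges at the same vertex) are identified. -/
def CayleyTree : Type := SeparationQuotient (EdgePoint ι)

noncomputable instance : MetricSpace (CayleyTree ι) :=
  inferInstanceAs (MetricSpace (SeparationQuotient (EdgePoint ι)))

namespace CayleyTree

/-- The point at position `s` on the edge from `a` to `a * x`. -/
def point (a : FreeGroup ι) (x : ι) (s : I) : CayleyTree ι :=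
  SeparationQuotient.mk (⟨a, x, s⟩ : EdgePoint ι)

theorem dist_point (a b : FreeGroup ι) (x y : ι) (s t : I) :
    dist (point a x s) (point b y t) =
      EdgePoint.pathDist (⟨a, x, s⟩ : EdgePoint ι) ⟨b, y, t⟩ := rfl

theorem exists_point (p : CayleyTree ι) : ∃ a x s, p = point a x s := by
  induction p using Quotient.inductionOn with
  | h p => exact ⟨p.base, p.gen, p.pos, rfl⟩

/-- Left translation on the edges. -/
def shift (g : FreeGroup ι) (p : EdgePoint ι) : EdgePoint ι := ⟨g * p.base, p.gen, p.pos⟩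

theorem isometry_shift (g : FreeGroup ι) : Isometry (shift g) := by
  refine Isometry.of_dist_eq fun p q => ?_
  change EdgePoint.pathDist _ _ = EdgePoint.pathDist _ _
  simp [EdgePoint.pathDist, EdgePoint.toVertex, shift, mul_assoc, wordDist_mul_left]

/-- Left translation on the tree. -/
def translate (g : FreeGroup ι) : CayleyTree ι → CayleyTree ι :=
  Quotient.map' (shift g) fun p q h => by
    have h' : Inseparable p q := h
    exact h'.map (isometry_shift g).continuous

theorem translate_point (g a : FreeGroup ι) (x : ι) (s : I) :
    translate g (point a x s) = point (g * a) x s := rfl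

theorem isometry_translate (g : FreeGroup ι) : Isometry (translate (ι := ι) g) := by
  refine Isometry.of_dist_eq fun p q => ?_
  obtain ⟨a, x, s, rfl⟩ := exists_point p
  obtain ⟨b, y, t, rfl⟩ := exists_point q
  exact (isometry_shift g).dist_eq ⟨a, x, s⟩ ⟨b, y, t⟩

theorem translate_mul (g h : FreeGroup ι) (p : CayleyTree ι) :
    translate (g * h) p = translate g (translate h p) := by
  obtain ⟨a, x, s, rfl⟩ := exists_point p
  simp [translate_point, mul_assoc]

theorem translate_one (p : CayleyTree ι) : translate 1 p = p := by
  obtain ⟨a, x, s, rfl⟩ := exists_point p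
  simp [translate_point]

/-- The natural action of the free group on its Cayley tree. -/
def action : FreeGroup ι →* (CayleyTree ι ≃ᵢ CayleyTree ι) where
  toFun g :=
    { toFun := translate g
      invFun := translate g⁻¹
      left_inv := fun p => by rw [← translate_mul, inv_mul_cancel, translate_one]
      right_inv := fun p => by rw [← translate_mul, mul_inv_cancel, translate_one]
      isometry_toFun := isometry_translate g }
  map_one' := by ext p; exact translate_one p
  map_mul' g h := by ext p; exact translate_mul g h p

end CayleyTree
end Tree

/-! ### The wreath product `K wr_C (C * D)` and its action -/

section Example

variable (K : Type u) [Group K] (n d : ℕ)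

/-- `C = ⟨a_1, …, a_n⟩`. -/
abbrev GrpC : Type := FreeGroup (Fin n)

/-- `A = C * D`, free on the `n` generators of `C` and the `d` generators of `D`. -/
abbrev GrpA : Type := FreeGroup (Fin n ⊕ Fin d)

/-- The projection `A → C` which kills `D`. -/
def proj : GrpA n d →* GrpC n :=
  FreeGroup.lift (Sum.elim FreeGroup.of fun _ => 1)

/-- `B`, the restricted direct sum of copies of `K` indexed by `C`. -/
def Base : Subgroup (GrpC n → K) where
  carrier := {x | (Function.mulSupport x).Finite}
  one_mem' := by simp
  mul_mem' {x y} hx hy := (Set.Finite.union hx hy).subset (Function.mulSupport_mul x y)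
  inv_mem' {x} hx := by
    change (Function.mulSupport x⁻¹).Finite
    rw [Function.mulSupport_inv]
    exact hx

/-- `a ∈ A` permutes the indices by left multiplication with the image of `a` in `C`. -/
def permute (a : GrpA n d) (x : Base K n) : Base K n :=
  ⟨fun ω => x.1 ((proj n d a)⁻¹ * ω), by
    have hx : (Function.mulSupport x.1).Finite := x.2
    change (Function.mulSupport fun ω => x.1 ((proj n d a)⁻¹ * ω)).Finite
    refine (hx.image fun ω => proj n d a * ω).subset fun ω hω => ?_
    exact ⟨(proj n d a)⁻¹ * ω, hω, by simp⟩⟩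

/-- The action `φ : A → Aut(B)`. -/
def phi : GrpA n d →* MulAut (Base K n) where
  toFun a :=
    { toFun := permute K n d a
      invFun := permute K n d a⁻¹
      left_inv := fun x => by ext ω; simp [permute]
      right_inv := fun x => by ext ω; simp [permute]
      map_mul' := fun x y => rfl }
  map_one' := by ext x ω; simp [permute]
  map_mul' a b := by
    ext x ω
    change x.1 ((proj n d (a * b))⁻¹ * ω) = x.1 ((proj n d b)⁻¹ * ((proj n d a)⁻¹ * ω))
    simp [mul_assoc]

/-- `G = K wr_C A = B ⋊ A`. -/
abbrev Wreath : Type u := Base K n ⋊[phi K n d] GrpA n d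

/-- The action of `G` on the Cayley tree of `A` through the projection `G → A`. -/
noncomputable def rho : Wreath K n d →*
    (CayleyTree (Fin n ⊕ Fin d) ≃ᵢ CayleyTree (Fin n ⊕ Fin d)) :=
  CayleyTree.action.comp SemidirectProduct.rightHom

variable {n d}

/-- The ray reads a letter from `D` at time `t`: between the times `t` and `t + 1` it runs through
an edge labelled by a generator of `D`, forwards or backwards. -/
def ReadsLetterFromD (τ : GeodesicRay (CayleyTree (Fin n ⊕ Fin d))) (t : ℝ≥0) : Prop :=
  ∃ (a : GrpA n d) (j : Fin d),
    (τ.toFun t = CayleyTree.point a (Sum.inr j) 0 ∧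
      τ.toFun (t + 1) = CayleyTree.point a (Sum.inr j) 1) ∨
    (τ.toFun t = CayleyTree.point a (Sum.inr j) 1 ∧
      τ.toFun (t + 1) = CayleyTree.point a (Sum.inr j) 0)

end Example
end SigmaInv

/-! A vertex of the Cayley graph of `G` is a pair `(b, a)`. A letter of `A` moves `a` and keeps `b`;
a generator from `K` keeps `a` and changes `b` only at the index `proj a`. Horoballs of the tree are
nested unions of balls, so `a` moves freely inside them. What matters is therefore which indices of
`C` are projections of vertices of the horoball.

If the ray reads letters from `D` infinitely often, its projection to `C` falls behind the ray by
any prescribed amount (`exists_vertex_wordDist_proj_add_le`). A given index `ω` is then reached from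
a far vertex of the ray by walking along letters of `C` without leaving the horoball. Each horoball
projects onto `C`, so the part of the Cayley graph over it is connected (`joinedIn_cayleyGraph`) and
lag `0` suffices.

If the ray reads no letter from `D` after a vertex `a₀`, its projection is geodesic from there on
(`exists_vertex_proj_eq`), and vertices deep in the horoball project far away from `ω = proj a₀`.
The coordinate `ω` of `b` is then constant along paths over a deep horoball, while an element of `K`
placed at `ω` acts trivially on the tree and changes this coordinate.

`Sigma1` asks for some graph, control map and asymptotic ray. One direction can use the Cayley graph
with the given ray; the other treats all choices, with bounded errors (`exists_wreath_coordinates`).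
-/

namespace SigmaInv

/-! ### Vertices of the Cayley tree -/

namespace CayleyTree

variable {ι : Type} [DecidableEq ι]

/-- The vertex `a`, viewed as the initial point of the edge labelled `o`. -/
def vertex (o : ι) (a : FreeGroup ι) : CayleyTree ι := point a o 0

theorem dist_point_point_zero (a b : FreeGroup ι) (x y : ι) (s : I) :
    dist (point b y s) (point a x 0) = EdgePoint.toVertex ⟨b, y, s⟩ a := by
  have h0 := s.2.1
  have h1 := s.2.2
  rw [dist_point]
  unfold EdgePoint.pathDist
  split_ifs with h
  · obtain ⟨rfl, rfl⟩ := h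
    simp only [EdgePoint.toVertex, wordDist_self, wordDist_comm (b * _) b, wordDist_edge]
    simp only [Set.Icc.coe_zero, sub_zero, add_zero]
    rw [abs_of_nonneg h0, min_eq_left (by linarith)]
  · have h3 := EdgePoint.toVertex_le (⟨b, y, s⟩ : EdgePoint ι) (a * FreeGroup.of x) a
    rw [wordDist_comm, wordDist_edge] at h3
    simp only [Set.Icc.coe_zero, add_zero, sub_zero]
    exact min_eq_left h3

theorem dist_point_vertex (o : ι) (a b : FreeGroup ι) (y : ι) (s : I) :
    dist (point b y s) (vertex o a) =
      min (s + wordDist b a) (1 - s + wordDist (b * FreeGroup.of y) a) :=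
  dist_point_point_zero a b o y s

theorem point_zero (o : ι) (a : FreeGroup ι) (x : ι) : point a x 0 = vertex o a := by
  rw [← dist_eq_zero, dist_point_vertex, wordDist_self, wordDist_comm, wordDist_edge]
  simp

theorem point_one (o : ι) (a : FreeGroup ι) (x : ι) :
    point a x 1 = vertex o (a * FreeGroup.of x) := by
  rw [← dist_eq_zero, dist_point_vertex, wordDist_self, wordDist_edge]
  simp

theorem dist_vertex_vertex (o : ι) (a b : FreeGroup ι) :
    dist (vertex o a) (vertex o b) = wordDist a b := by
  rw [vertex, dist_point_vertex]
  have := wordDist_triangle a (a * FreeGroup.of o) b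
  rw [wordDist_edge] at this
  simpa using this

theorem translate_vertex (o : ι) (g a : FreeGroup ι) :
    translate g (vertex o a) = vertex o (g * a) := rfl

theorem exists_dist_vertex_le_one (o : ι) (p : CayleyTree ι) : ∃ a, dist p (vertex o a) ≤ 1 := by
  obtain ⟨a, x, s, rfl⟩ := exists_point p
  refine ⟨a, ?_⟩
  rw [dist_point_vertex, wordDist_self, add_zero]
  exact (min_le_left _ _).trans s.2.2

theorem exists_nat_wordDist (a b : FreeGroup ι) : ∃ m : ℕ, wordDist a b = m := ⟨_, rfl⟩

/-- A point at integral distance from a vertex is a vertex. -/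
theorem exists_eq_vertex_of_dist_eq_nat (o : ι) {a : FreeGroup ι} {p : CayleyTree ι} {m : ℕ}
    (h : dist p (vertex o a) = m) : ∃ b, p = vertex o b := by
  obtain ⟨b, y, s, rfl⟩ := exists_point p
  rw [dist_point_vertex] at h
  obtain ⟨k, hk⟩ := exists_nat_wordDist b a
  obtain ⟨l, hl⟩ := exists_nat_wordDist (b * FreeGroup.of y) a
  rw [hk, hl] at h
  have h0 := s.2.1
  have h1 := s.2.2
  have hs : (s : ℝ) = 0 ∨ (s : ℝ) = 1 := by
    -- Whichever term attains the minimum, `s` differs from an integer by an integer, up to sign.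
    have : ∃ z : ℤ, (s : ℝ) = z := by
      rcases min_choice ((s : ℝ) + k) (1 - s + l) with h' | h'
      · exact ⟨m - k, by push_cast; linarith⟩
      · exact ⟨1 + l - m, by push_cast; linarith⟩
    obtain ⟨z, hz⟩ := this
    rw [hz] at h0 h1 ⊢
    have h0' : 0 ≤ z := by exact_mod_cast h0
    have h1' : z ≤ 1 := by exact_mod_cast h1
    interval_cases z <;> simp
  rcases hs with hs | hs
  · exact ⟨b, by rw [show s = 0 from Subtype.ext hs, point_zero o]⟩
  · exact ⟨_, by rw [show s = 1 from Subtype.ext hs, point_one o]⟩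

/-- Points close to an interior point of an edge are on the same edge. -/
theorem same_edge_of_dist_lt {a b : FreeGroup ι} {x y : ι} {s t : I}
    (h : dist (point a x s) (point b y t) < min (s : ℝ) (1 - s)) : a = b ∧ x = y := by
  by_contra hne
  -- Between different edges a path leaves through an endpoint, which costs at least `s` or `1 - s`.
  rw [dist_point, EdgePoint.pathDist, if_neg hne] at h
  have h1 := wordDist_nonneg a b
  have h2 := wordDist_nonneg (a * FreeGroup.of x) b
  have h3 := wordDist_nonneg a (b * FreeGroup.of y)
  have h4 := wordDist_nonneg (a * FreeGroup.of x) (b * FreeGroup.of y)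
  have h5 := t.2.1
  have h6 := t.2.2
  simp only [EdgePoint.toVertex] at h
  grind

theorem dist_edge_le (o : ι) {a c : FreeGroup ι} (x : ι) {r : ℝ}
    (h : wordDist a c + 1 ≤ r ∨ wordDist (a * FreeGroup.of x) c + 1 ≤ r) (s : I) :
    dist (point a x s) (vertex o c) ≤ r := by
  have h0 := s.2.1
  have h1 := s.2.2
  rw [dist_point_vertex]
  rcases h with h | h
  · exact (min_le_left _ _).trans (by linarith)
  · exact (min_le_right _ _).trans (by linarith)

end CayleyTree

open CayleyTree

/-! ### Geodesic rays in the Cayley tree -/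

namespace GeodesicRay

theorem dist_eq {M : Type*} [MetricSpace M] (τ : GeodesicRay M) (s t : ℝ≥0) :
    dist (τ.toFun s) (τ.toFun t) = |(s : ℝ) - t| := by
  rw [τ.isometry.dist_eq, NNReal.dist_eq]

variable {ι : Type} [DecidableEq ι] (o : ι) (τ : GeodesicRay (CayleyTree ι))

theorem exists_vertex_add_nat {t : ℝ≥0} {a : FreeGroup ι} (h : τ.toFun t = vertex o a) (m : ℕ) :
    ∃ b, τ.toFun (t + m) = vertex o b ∧ wordDist a b = m := by
  have hd : dist (τ.toFun (t + m)) (vertex o a) = m := by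
    rw [← h, τ.dist_eq]
    simp
  obtain ⟨b, hb⟩ := exists_eq_vertex_of_dist_eq_nat o hd
  refine ⟨b, hb, ?_⟩
  rw [← hd, hb, dist_vertex_vertex, wordDist_comm]

/-- Every ray passes through a vertex. -/
theorem exists_vertex : ∃ t a, τ.toFun t = vertex o a := by
  -- Otherwise the open edge containing `τ t` is locally constant in `t`, hence constant, although
  -- two of its points are at distance less than `1`.
  by_contra! hne
  choose a x s hp using fun t => exists_point (τ.toFun t)
  have hpos : ∀ t, 0 < min (s t : ℝ) (1 - s t) := by
    intro t
    have h0 : s t ≠ 0 := fun h => hne t _ (by rw [hp, h, point_zero o])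
    have h1 : s t ≠ 1 := fun h => hne t _ (by rw [hp, h, point_one o])
    exact lt_min (unitInterval.pos_iff_ne_zero.2 h0)
      (sub_pos.2 (unitInterval.lt_one_iff_ne_one.2 h1))
  have hloc : IsLocallyConstant fun t => (a t, x t) := by
    rw [IsLocallyConstant.iff_eventually_eq]
    intro t
    filter_upwards [Metric.ball_mem_nhds t (hpos t)] with t' ht'
    rw [Metric.mem_ball, dist_comm, ← τ.isometry.dist_eq, hp, hp] at ht'
    obtain ⟨h1, h2⟩ := same_edge_of_dist_lt ht'
    simp [h1, h2]
  have h01 := hloc.apply_eq_of_isPreconnected isPreconnected_univ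
    (Set.mem_univ (0 : ℝ≥0)) (Set.mem_univ (1 : ℝ≥0))
  simp only [Prod.mk.injEq] at h01
  have hd := τ.dist_eq 0 1
  rw [hp, hp, dist_point, EdgePoint.pathDist, if_pos h01] at hd
  have p0 := hpos 0
  have p1 := hpos 1
  rw [lt_min_iff] at p0 p1
  simp only [NNReal.coe_zero, NNReal.coe_one, zero_sub, abs_neg, abs_one] at hd
  rcases abs_cases ((s 0 : ℝ) - s 1) with ⟨h, -⟩ | ⟨h, -⟩ <;> rw [h] at hd <;> linarith

end GeodesicRay

/-- The balls that make up a horoball are nested, so the centre may always be pushed further along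
the ray. -/
theorem dist_ray_le_of_le {M : Type*} [MetricSpace M] (τ : GeodesicRay M) {k : ℝ} {x : M}
    {l l' : ℝ≥0} (hll : l ≤ l') (h : dist x (τ.toFun l) ≤ l - k) :
    dist x (τ.toFun l') ≤ l' - k := by
  have h1 := dist_triangle x (τ.toFun l) (τ.toFun l')
  have h2 : (l : ℝ) ≤ l' := hll
  rw [τ.dist_eq l l', abs_sub_comm, abs_of_nonneg (by linarith)] at h1
  linarith

/-! ### Words and the projection `A → C` -/

section Words

variable {ι : Type}

theorem mk_letter (z : ι × Bool) :
    FreeGroup.mk [z] = FreeGroup.of z.1 ∨ FreeGroup.mk [z] = (FreeGroup.of z.1)⁻¹ := by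
  rcases z with ⟨x, _ | _⟩
  · exact Or.inr rfl
  · exact Or.inl rfl

variable [DecidableEq ι]

/-- A homomorphism which does not lengthen the letters does not lengthen the words. -/
theorem norm_map_le {κ : Type} [DecidableEq κ] (f : FreeGroup ι →* FreeGroup κ)
    (hf : ∀ x, (f (FreeGroup.of x)).norm ≤ 1) (w : FreeGroup ι) : (f w).norm ≤ w.norm := by
  have key : ∀ L : List (ι × Bool), (f (FreeGroup.mk L)).norm ≤ L.length := by
    intro L
    induction L with
    | nil =>
      rw [← FreeGroup.one_eq_mk, map_one, FreeGroup.norm_one]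
      exact Nat.zero_le _
    | cons z L ih =>
      rw [show z :: L = [z] ++ L from rfl, ← FreeGroup.mul_mk, map_mul]
      refine (FreeGroup.norm_mul_le _ _).trans ?_
      have : (f (FreeGroup.mk [z])).norm ≤ 1 := by
        rcases mk_letter z with h | h
        · rw [h]; exact hf _
        · rw [h, map_inv, FreeGroup.norm_inv_eq]; exact hf _
      simp only [List.length_append, List.length_singleton]
      omega
  have := key w.toWord
  rwa [FreeGroup.mk_toWord] at this

theorem wordDist_map_le {κ : Type} [DecidableEq κ] (f : FreeGroup ι →* FreeGroup κ)
    (hf : ∀ x, (f (FreeGroup.of x)).norm ≤ 1) (a b : FreeGroup ι) :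
    wordDist (f a) (f b) ≤ wordDist a b := by
  unfold wordDist
  rw [← map_inv, ← map_mul]
  exact_mod_cast norm_map_le f hf _

theorem exists_letter_of_wordDist_eq_one {a b : FreeGroup ι} (h : wordDist a b = 1) :
    ∃ x, b = a * FreeGroup.of x ∨ a = b * FreeGroup.of x := by
  have h' : (a⁻¹ * b).norm = 1 := by
    unfold wordDist at h
    exact_mod_cast h
  obtain ⟨z, hz⟩ := List.length_eq_one_iff.1 h'
  have hab : a⁻¹ * b = FreeGroup.mk [z] := by rw [← hz, FreeGroup.mk_toWord]
  refine ⟨z.1, ?_⟩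
  rcases mk_letter z with h | h <;> rw [h] at hab
  · exact Or.inl (by rw [← hab]; group)
  · refine Or.inr ?_
    rw [← inv_inv (FreeGroup.of z.1), ← hab]
    group

end Words

variable {n d : ℕ}

theorem proj_inl (i : Fin n) : proj n d (FreeGroup.of (Sum.inl i)) = FreeGroup.of i := by
  simp [proj]

theorem proj_inr (j : Fin d) : proj n d (FreeGroup.of (Sum.inr j)) = 1 := by
  simp [proj]

theorem wordDist_proj_le (a b : GrpA n d) :
    wordDist (proj n d a) (proj n d b) ≤ wordDist a b := by
  refine wordDist_map_le _ ?_ a b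
  rintro (i | j)
  · rw [proj_inl, FreeGroup.norm_of]
  · rw [proj_inr, FreeGroup.norm_one]
    exact zero_le_one

/-- The inclusion `C → A`. -/
def incl (n d : ℕ) : GrpC n →* GrpA n d := FreeGroup.map Sum.inl

theorem incl_of (i : Fin n) : incl n d (FreeGroup.of i) = FreeGroup.of (Sum.inl i) := rfl

theorem proj_incl (c : GrpC n) : proj n d (incl n d c) = c := by
  have : (proj n d).comp (incl n d) = MonoidHom.id _ := by
    ext i
    simp [incl_of, proj_inl]
  exact DFunLike.congr_fun this c

theorem wordDist_incl_le (a b : GrpC n) :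
    wordDist (incl n d a) (incl n d b) ≤ wordDist a b :=
  wordDist_map_le _ (fun i => by rw [incl_of, FreeGroup.norm_of]) a b

/-! ### Letters from `D` along a ray -/

section Letters

variable (o : Fin n ⊕ Fin d) {τ : GeodesicRay (CayleyTree (Fin n ⊕ Fin d))}

/-- While a ray reads no letter from `D`, its projection to `C` is geodesic. -/
theorem exists_vertex_proj_eq {t : ℝ≥0} {a : GrpA n d} (ha : τ.toFun t = vertex o a)
    (hD : ∀ t', t ≤ t' → ¬ ReadsLetterFromD τ t') (m : ℕ) :
    ∃ b, τ.toFun (t + m) = vertex o b ∧ wordDist (proj n d a) (proj n d b) = m := by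
  -- Without letters from `D` the ray stays in the coset of `C` through `a`.
  have key : ∀ m : ℕ, ∃ c : GrpC n, τ.toFun (t + m) = vertex o (a * incl n d c) := by
    intro m
    induction m with
    | zero => exact ⟨1, by simp [ha]⟩
    | succ m ih =>
      obtain ⟨c, hc⟩ := ih
      obtain ⟨b, hb, hdist⟩ := τ.exists_vertex_add_nat o hc 1
      rw [Nat.cast_one] at hb hdist
      have hno := hD (t + m) le_self_add
      obtain ⟨i | j, hx⟩ := exists_letter_of_wordDist_eq_one hdist
      · rw [Nat.cast_succ, ← add_assoc, hb]
        rcases hx with hx | hx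
        · exact ⟨c * FreeGroup.of i, by rw [hx, map_mul, incl_of, mul_assoc]⟩
        · refine ⟨c * (FreeGroup.of i)⁻¹, ?_⟩
          rw [map_mul, map_inv, incl_of, ← mul_assoc, hx, mul_inv_cancel_right]
      · refine absurd ?_ hno
        rcases hx with hx | hx
        · refine ⟨a * incl n d c, j, Or.inl ⟨?_, ?_⟩⟩
          · rw [point_zero o, hc]
          · rw [point_one o, hb, hx]
        · refine ⟨b, j, Or.inr ⟨?_, ?_⟩⟩
          · rw [point_one o, hc, ← hx]
          · rw [point_zero o, hb]
  obtain ⟨c, hc⟩ := key m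
  obtain ⟨b, hb, hdist⟩ := τ.exists_vertex_add_nat o ha m
  have hbc : vertex o b = vertex o (a * incl n d c) := by rw [← hb, hc]
  -- On this coset `proj` preserves distances: it is 1-Lipschitz and so is its section `incl`.
  refine ⟨_, hc, le_antisymm ?_ ?_⟩
  · refine (wordDist_proj_le _ _).trans ?_
    rw [← dist_vertex_vertex o, ← hbc, dist_vertex_vertex, hdist]
  · rw [← hdist, ← dist_vertex_vertex o, hbc, dist_vertex_vertex, map_mul, proj_incl]
    have h1 := wordDist_incl_le (d := d) 1 c
    rw [map_one] at h1
    have h2 := wordDist_mul_left a 1 (incl n d c)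
    have h3 := wordDist_mul_left (proj n d a) 1 c
    rw [mul_one] at h2 h3
    rwa [h2, h3]

/-- Reading a letter from `D` the ray runs between two vertices with the same projection. -/
theorem ReadsLetterFromD.exists_vertex {t : ℝ≥0} (h : ReadsLetterFromD τ t) :
    ∃ a b, τ.toFun t = vertex o a ∧ τ.toFun (t + 1) = vertex o b ∧ proj n d a = proj n d b := by
  obtain ⟨a, j, ⟨h1, h2⟩ | ⟨h1, h2⟩⟩ := h <;>
    rw [h1, h2, point_zero o, point_one o] <;>
    exact ⟨_, _, rfl, rfl, by rw [map_mul, proj_inr, mul_one]⟩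

/-- Reading times are times at vertices, so those before `t` differ from `t` by natural numbers and
are finite in number. -/
theorem exists_readsLetterFromD_ge (h : {t : ℝ≥0 | ReadsLetterFromD τ t}.Infinite)
    {t : ℝ≥0} {a : GrpA n d} (ha : τ.toFun t = vertex o a) :
    ∃ t', t ≤ t' ∧ ReadsLetterFromD τ t' := by
  by_contra! hne
  refine h (((Set.finite_Iic ⌈(t : ℝ)⌉₊).image fun m : ℕ => t - m).subset ?_)
  intro t' ht'
  have hlt : t' < t := lt_of_not_ge fun h => hne t' h ht'
  obtain ⟨b, -, hb, -⟩ := ReadsLetterFromD.exists_vertex o ht'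
  obtain ⟨m, hm⟩ := exists_nat_wordDist a b
  have hlt' : (t' : ℝ) < t := hlt
  have hd := τ.dist_eq t t'
  rw [ha, hb, dist_vertex_vertex, hm, abs_of_nonneg (by linarith)] at hd
  refine ⟨m, ?_, ?_⟩
  · rw [Set.mem_Iic]
    have h1 := Nat.le_ceil (t : ℝ)
    have h2 := t'.2
    exact_mod_cast (show (m : ℝ) ≤ ⌈(t : ℝ)⌉₊ by
      rw [hd]; linarith [show (0 : ℝ) ≤ t' from h2])
  · change t - (m : ℝ≥0) = t'
    have : (m : ℝ≥0) + t' = t := by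
      rw [← NNReal.coe_inj]
      push_cast
      linarith
    rw [← this, add_tsub_cancel_left]

/-- Each letter from `D` puts the projection to `C` behind. -/
theorem exists_vertex_wordDist_proj_add_le (h : {t : ℝ≥0 | ReadsLetterFromD τ t}.Infinite)
    {t : ℝ≥0} {a : GrpA n d} (ha : τ.toFun t = vertex o a) (k : ℕ) :
    ∃ t' b, t ≤ t' ∧ τ.toFun t' = vertex o b ∧
      wordDist (proj n d a) (proj n d b) + k ≤ t' - t := by
  induction k with
  | zero => exact ⟨t, a, le_rfl, ha, by simp [wordDist_self]⟩
  | succ k ih =>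
    obtain ⟨t₁, b, htt, hb, hk⟩ := ih
    obtain ⟨t₂, htt₂, hread⟩ := exists_readsLetterFromD_ge o h hb
    obtain ⟨b₂, b₃, h₂, h₃, heq⟩ := ReadsLetterFromD.exists_vertex o hread
    -- Up to `t₂` the projection gains at most the elapsed time; the letter read at `t₂` costs one
    -- more unit without moving the projection.
    refine ⟨t₂ + 1, b₃, (htt.trans htt₂).trans le_self_add, h₃, ?_⟩
    have hle : (t₁ : ℝ) ≤ t₂ := htt₂
    have hd := τ.dist_eq t₁ t₂
    rw [hb, h₂, dist_vertex_vertex, abs_sub_comm, abs_of_nonneg (by linarith)] at hd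
    have h5 := wordDist_proj_le b b₂
    have h6 := wordDist_triangle (proj n d a) (proj n d b) (proj n d b₂)
    rw [← heq]
    push_cast
    linarith

end Letters

/-! ### Topology of the realization -/

namespace GGraph

variable {G : Type u} [Group G] (Γ : GGraph G)

theorem continuous_edge (e : Γ.E) : Continuous (Γ.edge e) :=
  continuous_iSup_rng (i := e) continuous_coinduced_rng

theorem continuous_realization_iff {X : Type*} [TopologicalSpace X] {f : Γ.Realization → X} :
    Continuous f ↔ ∀ e, Continuous fun s => f (Γ.edge e s) := by
  unfold instTopologicalSpaceRealization
  rw [continuous_iSup_dom]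
  exact forall_congr' fun e => continuous_coinduced_dom

theorem edge_zero (e : Γ.E) : Γ.edge e 0 = Γ.vert (Γ.src e) := Quot.sound (Glue.src e)

theorem edge_one (e : Γ.E) : Γ.edge e 1 = Γ.vert (Γ.tgt e) := Quot.sound (Glue.tgt e)

theorem exists_vert_or_edge (x : Γ.Realization) :
    (∃ v, x = Γ.vert v) ∨ ∃ e s, x = Γ.edge e s := by
  induction x using Quot.inductionOn with
  | h x =>
    rcases x with v | ⟨e, s⟩
    · exact Or.inl ⟨v, rfl⟩
    · exact Or.inr ⟨e, s, rfl⟩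

/-- Maps out of the realization. -/
def desc {X : Type*} (f : Γ.V → X) (g : Γ.E → I → X) (h0 : ∀ e, g e 0 = f (Γ.src e))
    (h1 : ∀ e, g e 1 = f (Γ.tgt e)) : Γ.Realization → X :=
  Quot.lift (Sum.elim f fun p => g p.1 p.2) (by
    rintro _ _ (e | e)
    · exact h0 e
    · exact h1 e)

theorem mem_largestSubcomplex_vert {U : Set Γ.Realization} {v : Γ.V} (h : Γ.vert v ∈ U) :
    Γ.vert v ∈ Γ.largestSubcomplex U := by
  refine ⟨{Γ.vert v}, ⟨⟨{v}, ∅, by simp, by simp⟩, by simpa using h⟩, rfl⟩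

theorem mem_largestSubcomplex_edge {U : Set Γ.Realization} {e : Γ.E} (h : ∀ s, Γ.edge e s ∈ U)
    (s : I) : Γ.edge e s ∈ Γ.largestSubcomplex U := by
  refine ⟨_, ⟨⟨{Γ.src e, Γ.tgt e}, {e}, by simp, rfl⟩, ?_⟩, ?_⟩
  · rintro x (⟨v, rfl | rfl, rfl⟩ | hx)
    · rw [← edge_zero]; exact h 0
    · rw [← edge_one]; exact h 1
    · simp only [Set.mem_singleton_iff, Set.iUnion_iUnion_eq_left, Set.mem_range] at hx
      obtain ⟨s, rfl⟩ := hx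
      exact h s
  · exact Or.inr (by simp)

theorem cases_of_mem_largestSubcomplex {U : Set Γ.Realization} {x : Γ.Realization}
    (hx : x ∈ Γ.largestSubcomplex U) :
    (∃ v, x = Γ.vert v ∧ Γ.vert v ∈ U) ∨ ∃ e s, x = Γ.edge e s ∧ ∀ s, Γ.edge e s ∈ U := by
  obtain ⟨_, ⟨⟨V', E', -, rfl⟩, hU⟩, hx⟩ := hx
  rcases hx with ⟨v, hv, rfl⟩ | hx
  · exact Or.inl ⟨v, rfl, hU (Or.inl ⟨v, hv, rfl⟩)⟩
  · simp only [Set.mem_iUnion, Set.mem_range] at hx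
    obtain ⟨e, he, s, rfl⟩ := hx
    refine Or.inr ⟨e, s, rfl, fun s => hU (Or.inr ?_)⟩
    simp only [Set.mem_iUnion, Set.mem_range]
    exact ⟨e, he, s, rfl⟩

theorem joinedIn_edge {U : Set Γ.Realization} {e : Γ.E} (h : ∀ s, Γ.edge e s ∈ U) (s t : I) :
    JoinedIn (Γ.largestSubcomplex U) (Γ.edge e s) (Γ.edge e t) := by
  have hI : JoinedIn (Set.univ : Set I) s t := by
    have := isPathConnected_iff_pathConnectedSpace.1
      ((convex_Icc (0 : ℝ) 1).isPathConnected ⟨0, by simp⟩)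
    rw [joinedIn_univ]
    exact PathConnectedSpace.joined s t
  refine (hI.map (f := Γ.edge e) (Γ.continuous_edge e)).mono ?_
  rintro _ ⟨s, -, rfl⟩
  exact Γ.mem_largestSubcomplex_edge h s

/-- It suffices to join vertices. -/
theorem joinedIn_of_vert {U : Set Γ.Realization}
    (H : ∀ v w, Γ.vert v ∈ U → Γ.vert w ∈ U →
      JoinedIn (Γ.largestSubcomplex U) (Γ.vert v) (Γ.vert w))
    {x y : Γ.Realization} (hx : x ∈ Γ.largestSubcomplex U) (hy : y ∈ Γ.largestSubcomplex U) :
    JoinedIn (Γ.largestSubcomplex U) x y := by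
  have key : ∀ x ∈ Γ.largestSubcomplex U, ∃ v, Γ.vert v ∈ U ∧
      JoinedIn (Γ.largestSubcomplex U) x (Γ.vert v) := by
    intro x hx
    rcases Γ.cases_of_mem_largestSubcomplex hx with ⟨v, rfl, hv⟩ | ⟨e, s, rfl, he⟩
    · exact ⟨v, hv, JoinedIn.refl hx⟩
    · exact ⟨Γ.src e, by rw [← edge_zero]; exact he 0, by
        rw [← edge_zero]; exact Γ.joinedIn_edge he s 0⟩
  obtain ⟨v, hv, hxv⟩ := key x hx
  obtain ⟨w, hw, hyw⟩ := key y hy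
  exact (hxv.trans (H v w hv hw)).trans hyw.symm

/-- A set of vertices closed under the edges of a subcomplex contains, with a vertex, all
vertices that are joined to it in the subcomplex. -/
theorem mem_of_joinedIn {U : Set Γ.Realization} {X : Set Γ.V}
    (hX : ∀ e, (∀ s, Γ.edge e s ∈ U) → (Γ.src e ∈ X ↔ Γ.tgt e ∈ X)) {v w : Γ.V}
    (h : JoinedIn (Γ.largestSubcomplex U) (Γ.vert v) (Γ.vert w)) (hv : v ∈ X) : w ∈ X := by
  classical
  -- The indicator of `X`, extended affinely over all edges, is continuous and takes only the values
  -- `0` and `1` on the subcomplex; a path from `X` to its complement would pass through `1 / 2`.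
  let i : Γ.V → ℝ := fun v => if v ∈ X then 1 else 0
  let f : Γ.Realization → ℝ := Γ.desc i
    (fun e s => (1 - s) * i (Γ.src e) + s * i (Γ.tgt e)) (by simp) (by simp)
  have hf : Continuous f := by
    rw [continuous_realization_iff]
    intro e
    change Continuous fun s : I => (1 - (s : ℝ)) * i (Γ.src e) + s * i (Γ.tgt e)
    fun_prop
  have hi : ∀ v, i v = 0 ∨ i v = 1 := fun v => by
    by_cases h : v ∈ X <;> simp [i, h]
  have h01 : ∀ x ∈ Γ.largestSubcomplex U, f x = 0 ∨ f x = 1 := by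
    intro x hx
    rcases Γ.cases_of_mem_largestSubcomplex hx with ⟨v, rfl, -⟩ | ⟨e, s, rfl, he⟩
    · exact hi v
    · have : i (Γ.tgt e) = i (Γ.src e) := by simp only [i, hX e he]
      have h2 : f (Γ.edge e s) = i (Γ.src e) := by
        change (1 - (s : ℝ)) * i (Γ.src e) + s * i (Γ.tgt e) = _
        rw [this]
        ring
      rw [h2]
      exact hi _
  by_contra hw
  obtain ⟨γ, hγ⟩ := h
  have hc : Continuous fun s => f (γ s) := hf.comp γ.continuous
  have hmem : (1 / 2 : ℝ) ∈ Set.Icc (f (γ 1)) (f (γ 0)) := by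
    rw [γ.source, γ.target, show f (Γ.vert v) = 1 from if_pos hv,
      show f (Γ.vert w) = 0 from if_neg hw]
    norm_num
  obtain ⟨s, hs⟩ := mem_range_of_exists_le_of_exists_ge hc ⟨1, hmem.1⟩ ⟨0, hmem.2⟩
  rcases h01 _ (hγ s) with h | h <;> simp only [h] at hs <;> norm_num at hs

end GGraph

/-! ### Coordinates on a free cocompact graph -/

/-- An invariant function takes only finitely many values, one per orbit. -/
theorem exists_bound_of_smul_invariant {G X : Type*} [Group G] [MulAction G X]
    [Finite (MulAction.orbitRel.Quotient G X)] (f : X → ℝ) (hf : ∀ (g : G) x, f (g • x) = f x) :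
    ∃ N, ∀ x, f x ≤ N := by
  let F : MulAction.orbitRel.Quotient G X → ℝ := fun q => f q.out
  obtain ⟨N, hN⟩ := (Set.finite_range F).bddAbove
  refine ⟨N, fun x => ?_⟩
  have h : (MulAction.orbitRel G X) (Quotient.mk (MulAction.orbitRel G X) x).out x :=
    Quotient.mk_out x
  obtain ⟨g, hg⟩ := h
  have h2 : f (Quotient.mk (MulAction.orbitRel G X) x).out = f x := by
    rw [← hg]
    exact hf g x
  rw [← h2]
  exact hN ⟨_, rfl⟩

/-- A free action has equivariant coordinates in the group. -/
theorem exists_equivariant_of_free {G X : Type*} [Group G] [MulAction G X]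
    (hfree : ∀ (g : G) (x : X), g • x = x → g = 1) :
    ∃ (q : X → G) (r : X → X), (∀ x, q x • r x = x) ∧ (∀ g x, q (g • x) = g * q x) ∧
      ∀ (g : G) x, r (g • x) = r x := by
  let r : X → X := fun x => (Quotient.mk (MulAction.orbitRel G X) x).out
  have hr : ∀ x, ∃ g : G, g • r x = x := fun x => by
    obtain ⟨g, hg⟩ : (MulAction.orbitRel G X) (r x) x := Quotient.mk_out x
    exact ⟨g⁻¹, by rw [← hg]; exact inv_smul_smul g x⟩
  choose q hq using hr
  have hinv : ∀ (g : G) x, r (g • x) = r x := fun g x => by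
    have : Quotient.mk (MulAction.orbitRel G X) (g • x) = Quotient.mk _ x :=
      Quotient.sound ⟨g, rfl⟩
    simp only [r, this]
  refine ⟨q, r, hq, fun g x => ?_, hinv⟩
  have h1 := hq (g • x)
  rw [hinv] at h1
  have h2 : (q (g • x))⁻¹ • (g * q x) • r x = r x := by
    rw [mul_smul, hq x, inv_smul_eq_iff, h1]
  rw [← mul_smul] at h2
  exact inv_mul_eq_one.1 (hfree _ _ h2)

/-! ### The obstruction when the letters from `D` stop -/

section Wreath

variable {K : Type u} [Group K] {n d : ℕ}

theorem exists_support_bound (b : Base K n) :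
    ∃ N : ℕ, ∀ ω, b.1 ω ≠ 1 → FreeGroup.norm ω ≤ N := by
  have hb : (Function.mulSupport b.1).Finite := b.2
  obtain ⟨N, hN⟩ := (hb.image FreeGroup.norm).bddAbove
  exact ⟨N, fun ω hω => hN ⟨ω, hω, rfl⟩⟩

theorem phi_apply (a : GrpA n d) (b : Base K n) (ω : GrpC n) :
    (phi K n d a b).1 ω = b.1 ((proj n d a)⁻¹ * ω) := rfl

theorem rho_apply (g : Wreath K n d) (p : CayleyTree (Fin n ⊕ Fin d)) :
    rho K n d g p = translate g.right p := rfl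

/-- Coordinates in `G` on the vertices of a free cocompact graph, compatible with a control map
up to a bounded error; an edge changes the part in `B` only near the projection of the part
in `A`. -/
theorem exists_wreath_coordinates (o : Fin n ⊕ Fin d) {Γ : GGraph (Wreath K n d)}
    (hΓ : Γ.IsFreeCocompactConnected) {h : Γ.Realization → CayleyTree (Fin n ⊕ Fin d)}
    (hh : Γ.IsControlMap (rho K n d) h) :
    ∃ (q : Γ.V → Wreath K n d) (R N : ℝ), (∀ g v, q (g • v) = g * q v) ∧
      (∀ v, dist (h (Γ.vert v)) (vertex o (q v).right) ≤ R) ∧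
      ∀ e ω, (q (Γ.src e)).left.1 ω ≠ (q (Γ.tgt e)).left.1 ω →
        wordDist (proj n d (q (Γ.src e)).right) ω ≤ N := by
  obtain ⟨q, r, hq, hqg, hrg⟩ := exists_equivariant_of_free hΓ.free
  have := hΓ.finite_V
  have := hΓ.finite_E
  obtain ⟨R, hR⟩ := exists_bound_of_smul_invariant (G := Wreath K n d)
    (fun v => dist (h (Γ.vert (r v))) (vertex o 1)) fun g v => by rw [hrg]
  choose supp hsupp using exists_support_bound (K := K) (n := n)
  -- The transition element `(q src)⁻¹ * q tgt` of an edge is invariant under `G`, so the supports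
  -- of all `B`-parts lie in one ball about `1` in `C`.
  obtain ⟨N, hN⟩ := exists_bound_of_smul_invariant (G := Wreath K n d)
    (fun e => (supp ((q (Γ.src e))⁻¹ * q (Γ.tgt e)).left : ℝ)) fun g e => by
      rw [Γ.src_smul, Γ.tgt_smul, hqg, hqg, mul_inv_rev, mul_assoc, inv_mul_cancel_left]
  refine ⟨q, R, N, hqg, fun v => ?_, fun e ω hω => ?_⟩
  · have h1 : h (Γ.vert v) = translate (q v).right (h (Γ.vert (r v))) := by
      rw [← rho_apply, ← hh.map_vert, hq]
    have h2 := (isometry_translate (q v).right).dist_eq (h (Γ.vert (r v))) (vertex o 1)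
    rw [translate_vertex, mul_one, ← h1] at h2
    rw [h2]
    exact hR v
  · refine le_trans ?_ (hN e)
    unfold wordDist
    refine Nat.cast_le.2 (hsupp _ _ fun h1 => hω ?_)
    -- In this product the `B`-part of the transition is translated by the projection of the
    -- `A`-part of `q src`.
    have h2 : q (Γ.tgt e) = q (Γ.src e) * ((q (Γ.src e))⁻¹ * q (Γ.tgt e)) := by group
    rw [h2, SemidirectProduct.mul_left]
    change _ = (q (Γ.src e)).left.1 ω * _
    rw [phi_apply, h1, mul_one]

/-- The element of `B` with value `k` at `ω` and trivial elsewhere. -/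
def single (ω : GrpC n) (k : K) : Base K n :=
  ⟨Pi.mulSingle ω k, (Set.finite_singleton ω).subset Pi.mulSupport_mulSingle_subset⟩

theorem single_apply (ω ω' : GrpC n) (k : K) :
    (single ω k).1 ω' = if ω' = ω then k else 1 := Pi.mulSingle_apply ω k ω'

theorem infinite_of_controlledConnected [Nontrivial K] (o : Fin n ⊕ Fin d)
    {τ τ' : GeodesicRay (CayleyTree (Fin n ⊕ Fin d))} {R₀ : ℝ}
    (hR₀ : ∀ t, dist (τ'.toFun t) (τ.toFun t) ≤ R₀) {Γ : GGraph (Wreath K n d)}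
    (hΓ : Γ.IsFreeCocompactConnected) {h : Γ.Realization → CayleyTree (Fin n ⊕ Fin d)}
    (hh : Γ.IsControlMap (rho K n d) h) (hcc : Γ.ControlledConnected h τ') :
    {t : ℝ≥0 | ReadsLetterFromD τ t}.Infinite := by
  intro hfin
  obtain ⟨t₀, a₀, hta₀, hno⟩ : ∃ t₀ a₀, τ.toFun t₀ = vertex o a₀ ∧
      ∀ t, t₀ ≤ t → ¬ ReadsLetterFromD τ t := by
    obtain ⟨t₁, a₁, h₁⟩ := τ.exists_vertex o
    obtain ⟨u, hu⟩ := hfin.bddAbove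
    obtain ⟨m, hm⟩ := exists_nat_gt u
    obtain ⟨b, hb, -⟩ := τ.exists_vertex_add_nat o h₁ m
    refine ⟨_, b, hb, fun t ht hread => ?_⟩
    exact absurd ((le_add_self.trans ht).trans (hu hread)) (not_le.2 hm)
  obtain ⟨q, R, N, hqg, hR, hN⟩ := exists_wreath_coordinates o hΓ hh
  obtain ⟨lag, hlag, hlim⟩ := hcc
  -- The threshold adds up the width `N` of a change, the starting time `t₀` and the errors of the
  -- coordinates (`R`) and of the asymptotic ray (`R₀`).
  obtain ⟨t, ht⟩ := (hlim.eventually_gt_atTop (N + t₀ + R + R₀)).exists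
  set ω := proj n d a₀
  -- the coordinate `ω` does not change along edges over the horoball
  have hedge : ∀ e, (∀ s, Γ.edge e s ∈ h ⁻¹' horoball τ' (t - lag t)) →
      (q (Γ.src e)).left.1 ω = (q (Γ.tgt e)).left.1 ω := by
    intro e he
    by_contra hne
    have h1 := hN e ω hne
    have h0 := he 0
    rw [Γ.edge_zero] at h0
    obtain ⟨l, -, hl⟩ := h0
    obtain ⟨m, hm⟩ := exists_nat_gt l
    have hlm : l ≤ t₀ + m := hm.le.trans le_add_self
    have h2 := dist_ray_le_of_le τ' hlm hl
    obtain ⟨b, hb, hdist⟩ := exists_vertex_proj_eq o hta₀ hno m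
    have h3 := hR₀ (t₀ + m)
    have h4 := hR (Γ.src e)
    -- The projection of `b` is at distance exactly `m` from `ω`; a changing edge would reach it
    -- within `N + R + R₀ + t₀ + m - (t - lag t)`, which is less than `m`.
    set a := (q (Γ.src e)).right
    have h5 := dist_triangle4 (vertex o a) (h (Γ.vert (Γ.src e))) (τ'.toFun (t₀ + m))
      (τ.toFun (t₀ + m))
    rw [hb, dist_vertex_vertex, dist_comm (vertex o a), ← hb] at h5
    have h6 := wordDist_proj_le a b
    have h7 := wordDist_triangle ω (proj n d a) (proj n d b)
    rw [wordDist_comm ω (proj n d a), hdist] at h7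
    push_cast at h2
    linarith
  -- a vertex over the horoball
  obtain ⟨v, hv⟩ : ∃ v, Γ.vert v ∈ h ⁻¹' horoball τ' t := by
    have := hΓ.connected
    obtain ⟨v₀⟩ : Nonempty Γ.V := by
      obtain ⟨x⟩ := this.nonempty
      rcases Γ.exists_vert_or_edge x with ⟨v, -⟩ | ⟨e, -⟩
      exacts [⟨v⟩, ⟨Γ.src e⟩]
    set D := dist (h (Γ.vert v₀)) (vertex o 1) with hD
    have hDnn : 0 ≤ D := dist_nonneg
    -- The ball about `τ' l` has radius at least `D + 1`: `1` to a vertex `a` near `τ' l`, and `D`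
    -- from there to the image of the translate of `v₀` by `a`.
    set l : ℝ≥0 := (t + D + 1).toNNReal
    have hl : t + D + 1 ≤ l := Real.le_coe_toNNReal _
    obtain ⟨a, ha⟩ := exists_dist_vertex_le_one o (τ'.toFun l)
    refine ⟨(SemidirectProduct.inr a : Wreath K n d) • v₀, l, by linarith, ?_⟩
    rw [hh.map_vert, rho_apply, SemidirectProduct.right_inr]
    have h1 := (isometry_translate a).dist_eq (h (Γ.vert v₀)) (vertex o 1)
    rw [translate_vertex, mul_one, ← hD] at h1
    have h2 := dist_triangle_right (translate a (h (Γ.vert v₀))) (τ'.toFun l) (vertex o a)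
    linarith
  obtain ⟨k, hk⟩ := exists_ne (1 : K)
  -- As an element of `B`, `g` fixes the tree pointwise, so `g • v` lies over the same point as `v`;
  -- only the coordinate `ω` tells them apart.
  set g : Wreath K n d := SemidirectProduct.inl (single ω k) with hg
  have hgv : Γ.vert (g • v) ∈ h ⁻¹' horoball τ' t := by
    rw [Set.mem_preimage, hh.map_vert, rho_apply, hg, SemidirectProduct.right_inl, translate_one]
    exact hv
  have hjoin := hlag t _ (Γ.mem_largestSubcomplex_vert hv) _ (Γ.mem_largestSubcomplex_vert hgv)
  have hmem := Γ.mem_of_joinedIn (X := {w | (q w).left.1 ω = (q v).left.1 ω})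
    (fun e he => by simp only [Set.mem_ofPred_eq, hedge e he]) hjoin rfl
  rw [Set.mem_ofPred_eq, hqg, SemidirectProduct.mul_left, hg, SemidirectProduct.left_inl,
    SemidirectProduct.right_inl, map_one] at hmem
  change (single ω k).1 ω * (q v).left.1 ω = _ at hmem
  rw [single_apply, if_pos rfl] at hmem
  exact hk (mul_eq_right.1 hmem)

end Wreath

/-! ### The Cayley graph of the wreath product -/

section CayleyGraph

variable {K : Type u} [Group K] {n d : ℕ}

theorem single_one (ω : GrpC n) : single ω (1 : K) = 1 :=
  Subtype.ext (Pi.mulSingle_one ω)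

theorem single_mul (ω : GrpC n) (k l : K) : single ω (k * l) = single ω k * single ω l :=
  Subtype.ext (Pi.mulSingle_mul (f := fun _ => K) ω k l)

/-- This is why a generator from `K`, applied on the right at a vertex `(b, a)`, acts on the
coordinate `proj a` of `b`. -/
theorem phi_single (a : GrpA n d) (k : K) :
    phi K n d a (single 1 k) = single (proj n d a) k := by
  ext ω
  rw [phi_apply]
  simp only [single_apply]
  exact if_congr (inv_mul_eq_one.trans eq_comm) rfl rfl

/-- The elements of `B` are products of elements supported at one index. -/
theorem base_induction {p : Base K n → Prop} (one : p 1)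
    (mul : ∀ b ω k, p b → p (b * single ω k)) (b : Base K n) : p b := by
  have key : ∀ (s : Finset (GrpC n)) (b : Base K n), Function.mulSupport b.1 ⊆ s → p b := by
    intro s
    induction s using Finset.induction_on with
    | empty =>
      intro b hb
      have : b = 1 := Subtype.ext (by simpa using hb)
      rwa [this]
    | insert ω s _ ih =>
      intro b hb
      have h1 : b = (b * single ω (b.1 ω)⁻¹) * single ω (b.1 ω) := by
        rw [mul_assoc, ← single_mul, inv_mul_cancel, single_one, mul_one]
      rw [h1]
      refine mul _ _ _ (ih _ fun ω' hω' => ?_)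
      change b.1 ω' * (single ω (b.1 ω)⁻¹).1 ω' ≠ 1 at hω'
      rw [single_apply] at hω'
      by_cases h : ω' = ω
      · subst h
        simp at hω'
      · rw [if_neg h, mul_one] at hω'
        exact Finset.mem_coe.2 ((Finset.mem_insert.1 (hb hω')).resolve_left h)
  have hb : (Function.mulSupport b.1).Finite := b.2
  exact key hb.toFinset b (by simp)

/-- The generators of `G`: elements of `K` at the index `1`, and the letters of `A`. -/
def generator (S : Finset K) : S ⊕ (Fin n ⊕ Fin d) → Wreath K n d :=
  Sum.elim (fun k => SemidirectProduct.inl (single 1 k.1))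
    fun i => SemidirectProduct.inr (FreeGroup.of i)

variable (n d) in
/-- The Cayley graph of `G`. -/
def cayleyGraph (S : Finset K) : GGraph (Wreath K n d) where
  V := Wreath K n d
  E := Wreath K n d × (S ⊕ (Fin n ⊕ Fin d))
  src e := e.1
  tgt e := e.1 * generator S e.2
  actV := Monoid.toMulAction _
  actE :=
    { smul := fun g e => (g * e.1, e.2)
      one_smul := fun _ => Prod.ext (one_mul _) rfl
      mul_smul := fun g h e => Prod.ext (mul_assoc g h e.1) rfl }
  src_smul _ _ := rfl
  tgt_smul g e := mul_assoc g e.1 _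

variable (S : Finset K) (o : Fin n ⊕ Fin d)

/-- The projection of the Cayley graph of `G` to the Cayley tree of `A`. -/
noncomputable def cayleyMap : (cayleyGraph n d S).Realization → CayleyTree (Fin n ⊕ Fin d) :=
  (cayleyGraph n d S).desc (fun g => vertex o g.right)
    (fun p s => Sum.elim (fun _ => vertex o p.1.right) (fun i => point p.1.right i s) p.2)
    (by
      rintro ⟨g, k | i⟩
      · rfl
      · exact point_zero o _ _)
    (by
      rintro ⟨g, k | i⟩
      · change vertex o g.right = vertex o (g.right * 1)
        rw [mul_one]
      · exact point_one o _ _)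

theorem isControlMap_cayleyMap :
    (cayleyGraph n d S).IsControlMap (rho K n d) (cayleyMap S o) where
  continuous := by
    rw [GGraph.continuous_realization_iff]
    rintro ⟨g, k | i⟩
    · change Continuous fun _ : I => vertex o g.right
      exact continuous_const
    · refine (Isometry.of_dist_eq fun s t => ?_).continuous
      change dist (point g.right i s) (point g.right i t) = _
      rw [dist_point, EdgePoint.pathDist, if_pos ⟨rfl, rfl⟩]
      rfl
  map_vert _ _ := rfl
  map_edge g := by
    rintro ⟨g', k | i⟩ s <;> rfl

/-! ### Paths in the Cayley graph over a subset of the tree -/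

section Joined

variable {S} {U : Set (CayleyTree (Fin n ⊕ Fin d))}

/-- Two vertices are joined over `U`. -/
def JoinedOver (S : Finset K) (o : Fin n ⊕ Fin d) (U : Set (CayleyTree (Fin n ⊕ Fin d)))
    (g g' : Wreath K n d) : Prop :=
  JoinedIn ((cayleyGraph n d S).largestSubcomplex (cayleyMap S o ⁻¹' U))
    ((cayleyGraph n d S).vert g) ((cayleyGraph n d S).vert g')

variable {o}

theorem JoinedOver.of_edge {e : Wreath K n d × (S ⊕ (Fin n ⊕ Fin d))}
    (h : ∀ s, cayleyMap S o ((cayleyGraph n d S).edge e s) ∈ U) :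
    JoinedOver S o U e.1 (e.1 * generator S e.2) := by
  have := (cayleyGraph n d S).joinedIn_edge (U := cayleyMap S o ⁻¹' U) (e := e) h 0 1
  have h0 := (cayleyGraph n d S).edge_zero e
  have h1 := (cayleyGraph n d S).edge_one e
  rwa [h0, h1] at this

theorem JoinedOver.letter {a : GrpA n d} {i : Fin n ⊕ Fin d} (h : ∀ s, point a i s ∈ U)
    (b : Base K n) : JoinedOver S o U ⟨b, a⟩ ⟨b, a * FreeGroup.of i⟩ := by
  have := JoinedOver.of_edge (S := S) (o := o) (U := U) (e := (⟨b, a⟩, Sum.inr i)) h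
  have h2 : (⟨b, a⟩ * generator S (Sum.inr i) : Wreath K n d) = ⟨b, a * FreeGroup.of i⟩ := by
    refine SemidirectProduct.ext ?_ rfl
    change b * phi K n d a 1 = b
    rw [map_one, mul_one]
  rwa [h2] at this

theorem JoinedOver.mul_single_of_mem {a : GrpA n d} (h : vertex o a ∈ U) {k : K} (hk : k ∈ S)
    (b : Base K n) : JoinedOver S o U ⟨b, a⟩ ⟨b * single (proj n d a) k, a⟩ := by
  have := JoinedOver.of_edge (S := S) (o := o) (U := U) (e := (⟨b, a⟩, Sum.inl ⟨k, hk⟩))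
    fun _ => h
  have h2 : (⟨b, a⟩ * generator S (Sum.inl ⟨k, hk⟩) : Wreath K n d) =
      ⟨b * single (proj n d a) k, a⟩ := by
    refine SemidirectProduct.ext ?_ (mul_one a)
    change b * phi K n d a (single 1 k) = _
    rw [phi_single]
  rwa [h2] at this

theorem JoinedOver.refl {g : Wreath K n d} (h : vertex o g.right ∈ U) : JoinedOver S o U g g :=
  JoinedIn.refl (GGraph.mem_largestSubcomplex_vert _ h)

theorem JoinedOver.mul_single (hS : Subgroup.closure (S : Set K) = ⊤) {a : GrpA n d}
    (h : vertex o a ∈ U) (k : K) (b : Base K n) :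
    JoinedOver S o U ⟨b, a⟩ ⟨b * single (proj n d a) k, a⟩ := by
  have hk : k ∈ Subgroup.closure (S : Set K) := hS ▸ Subgroup.mem_top k
  induction hk using Subgroup.closure_induction generalizing b with
  | mem k hk => exact JoinedOver.mul_single_of_mem h hk b
  | one =>
    rw [single_one, mul_one]
    exact JoinedOver.refl h
  | mul k l _ _ ihk ihl =>
    rw [single_mul, ← mul_assoc]
    exact (ihk b).trans (ihl _)
  | inv k _ ih =>
    have := ih (b * single (proj n d a) k⁻¹)
    rw [mul_assoc, ← single_mul, inv_mul_cancel, single_one, mul_one] at this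
    exact this.symm

/-- Vertices of a ball are joined to its centre over the ball. -/
theorem JoinedOver.of_ball {c : GrpA n d} {r : ℝ} (hU : Metric.closedBall (vertex o c) r ⊆ U)
    {a : GrpA n d} (ha : dist (vertex o a) (vertex o c) ≤ r) (b : Base K n) :
    JoinedOver S o U ⟨b, a⟩ ⟨b, c⟩ := by
  -- Dropping the last letter of a word is one step along an edge whose shorter end is within `r -
  -- 1` of `c`, so the whole edge lies in the ball.
  have key : ∀ L : List ((Fin n ⊕ Fin d) × Bool), (L.length : ℝ) ≤ r →
      JoinedOver S o U ⟨b, c * FreeGroup.mk L⟩ ⟨b, c⟩ := by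
    intro L
    induction L using List.reverseRecOn with
    | nil =>
      intro hr
      rw [← FreeGroup.one_eq_mk, mul_one]
      exact JoinedOver.refl (hU (Metric.mem_closedBall_self (by simpa using hr)))
    | append_singleton L z ih =>
      intro hr
      rw [List.length_append, List.length_singleton, Nat.cast_add, Nat.cast_one] at hr
      have hL : wordDist (c * FreeGroup.mk L) c + 1 ≤ r := by
        have h1 : wordDist (c * FreeGroup.mk L) c ≤ L.length := by
          rw [wordDist_comm, wordDist, inv_mul_cancel_left]
          exact_mod_cast FreeGroup.norm_mk_le
        linarith
      refine JoinedIn.trans ?_ (ih (by linarith))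
      rw [← FreeGroup.mul_mk, ← mul_assoc]
      rcases mk_letter z with hz | hz <;> rw [hz]
      · refine (JoinedOver.letter (fun s => hU ?_) b).symm
        exact dist_edge_le o _ (Or.inl hL) s
      · have := JoinedOver.letter (S := S) (o := o) (U := U) (i := z.1)
          (a := c * FreeGroup.mk L * (FreeGroup.of z.1)⁻¹)
          (fun s => hU (dist_edge_le o _ (Or.inr (by rwa [inv_mul_cancel_right])) s)) b
        rwa [inv_mul_cancel_right] at this
  have := key (c⁻¹ * a).toWord (by
    rw [dist_comm, dist_vertex_vertex] at ha
    exact ha)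
  rwa [FreeGroup.mk_toWord, mul_inv_cancel_left] at this

/-- If any two vertices of `U` are in a ball contained in `U`, and the vertices of `U` project onto
`C`, then the part of the Cayley graph over `U` is connected. -/
theorem joinedIn_cayleyGraph (hS : Subgroup.closure (S : Set K) = ⊤)
    (hball : ∀ a a', vertex o a ∈ U → vertex o a' ∈ U → ∃ c r,
      Metric.closedBall (vertex o c) r ⊆ U ∧ dist (vertex o a) (vertex o c) ≤ r ∧
        dist (vertex o a') (vertex o c) ≤ r)
    (hproj : ∀ ω, ∃ a, vertex o a ∈ U ∧ proj n d a = ω) {x y : (cayleyGraph n d S).Realization}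
    (hx : x ∈ (cayleyGraph n d S).largestSubcomplex (cayleyMap S o ⁻¹' U))
    (hy : y ∈ (cayleyGraph n d S).largestSubcomplex (cayleyMap S o ⁻¹' U)) :
    JoinedIn ((cayleyGraph n d S).largestSubcomplex (cayleyMap S o ⁻¹' U)) x y := by
  refine (cayleyGraph n d S).joinedIn_of_vert ?_ hx hy
  rintro ⟨b, a⟩ ⟨b', a'⟩ (ha : vertex o a ∈ U) (ha' : vertex o a' ∈ U)
  change JoinedOver S o U ⟨b, a⟩ ⟨b', a'⟩
  have hmove : ∀ a a', vertex o a ∈ U → vertex o a' ∈ U → ∀ b,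
      JoinedOver S o U ⟨b, a⟩ ⟨b, a'⟩ := by
    intro a a' ha ha' b
    obtain ⟨c, r, hc, h1, h2⟩ := hball a a' ha ha'
    exact (JoinedOver.of_ball hc h1 b).trans (JoinedOver.of_ball hc h2 b).symm
  have hbase : ∀ f : Base K n, JoinedOver S o U ⟨b, a⟩ ⟨b * f, a⟩ := by
    intro f
    induction f using base_induction with
    | one =>
      rw [mul_one]
      exact JoinedOver.refl ha
    | mul f ω k ih =>
      obtain ⟨a₁, ha₁, rfl⟩ := hproj ω
      rw [← mul_assoc]
      -- Walk to a vertex `a₁` above the index, change the coordinate there, and walk back.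
      exact ((ih.trans (hmove a a₁ ha ha₁ _)).trans (JoinedOver.mul_single hS ha₁ k _)).trans
        (hmove a₁ a ha₁ ha _)
  have := (hbase (b⁻¹ * b')).trans (hmove a a' ha ha' _)
  rwa [mul_inv_cancel_left] at this

end Joined

/-! ### The Cayley graph as a witness for membership in `Sigma1` -/

variable {S}

theorem isFreeCocompactConnected_cayleyGraph (o : Fin n ⊕ Fin d)
    (hS : Subgroup.closure (S : Set K) = ⊤) :
    (cayleyGraph n d S).IsFreeCocompactConnected where
  free g (v : Wreath K n d) (hv : g * v = v) := mul_eq_right.1 hv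
  finite_V := by
    refine Finite.of_surjective
      (fun _ : Unit => Quotient.mk (MulAction.orbitRel (Wreath K n d) _) (1 : Wreath K n d)) ?_
    intro x
    obtain ⟨x, rfl⟩ := Quotient.exists_rep x
    refine ⟨(), (Quotient.sound ?_).symm⟩
    exact ⟨x, mul_one (M := Wreath K n d) x⟩
  finite_E := by
    refine Finite.of_surjective (fun z : S ⊕ (Fin n ⊕ Fin d) =>
      Quotient.mk (MulAction.orbitRel (Wreath K n d) _) ((1 : Wreath K n d), z)) ?_
    intro x
    obtain ⟨x, rfl⟩ := Quotient.exists_rep x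
    refine ⟨x.2, (Quotient.sound ?_).symm⟩
    exact ⟨x.1, Prod.ext (mul_one x.1) rfl⟩
  connected := by
    have hmem : ∀ x, x ∈ (cayleyGraph n d S).largestSubcomplex
        (cayleyMap S o ⁻¹' (Set.univ : Set (CayleyTree (Fin n ⊕ Fin d)))) := by
      intro x
      rcases (cayleyGraph n d S).exists_vert_or_edge x with ⟨v, rfl⟩ | ⟨e, s, rfl⟩
      · exact GGraph.mem_largestSubcomplex_vert _ (Set.mem_univ _)
      · exact GGraph.mem_largestSubcomplex_edge _ (fun _ => Set.mem_univ _) s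
    refine ⟨⟨(cayleyGraph n d S).vert (1 : Wreath K n d)⟩, fun x y => ?_⟩
    -- Connectedness of the whole graph is the criterion with `U` the entire tree.
    refine (joinedIn_cayleyGraph hS (fun a a' _ _ => ?_) (fun ω => ?_) (hmem x) (hmem y)).joined
    · exact ⟨a, dist (vertex o a') (vertex o a), Set.subset_univ _, by simp, le_rfl⟩
    · exact ⟨incl n d ω, trivial, proj_incl ω⟩

theorem endpoint_mem_sigma1 [Group.FG K] (o : Fin n ⊕ Fin d)
    {τ : GeodesicRay (CayleyTree (Fin n ⊕ Fin d))}
    (hinf : {t : ℝ≥0 | ReadsLetterFromD τ t}.Infinite) : τ.endpoint ∈ Sigma1 (rho K n d) := by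
  obtain ⟨S, hS⟩ := Group.FG.out (G := K)
  obtain ⟨t₀, a₀, h₀⟩ := τ.exists_vertex o
  refine ⟨τ, cayleyGraph n d S, cayleyMap S o, rfl, isFreeCocompactConnected_cayleyGraph o hS,
    isControlMap_cayleyMap S o, fun _ => 0, fun t x hx y hy => ?_,
    by simpa only [NNReal.coe_zero, sub_zero] using! tendsto_id⟩
  rw [NNReal.coe_zero, sub_zero]
  refine joinedIn_cayleyGraph (o := o) (U := horoball τ t) hS ?_ (fun ω => ?_) hx hy
  · rintro a a' ⟨l, hl, ha⟩ ⟨l', hl', ha'⟩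
    obtain ⟨m, hm⟩ := exists_nat_gt (max l l')
    obtain ⟨c, hc, -⟩ := τ.exists_vertex_add_nat o h₀ m
    have h1 : l ≤ t₀ + m := (le_max_left l l').trans (hm.le.trans le_add_self)
    have h2 : l' ≤ t₀ + m := (le_max_right l l').trans (hm.le.trans le_add_self)
    refine ⟨c, ((t₀ + m : ℝ≥0) : ℝ) - t, fun p hp => ⟨t₀ + m, hl.trans h1, ?_⟩, ?_, ?_⟩
    · rw [hc]
      exact hp
    · rw [← hc]
      exact dist_ray_le_of_le τ h1 ha
    · rw [← hc]
      exact dist_ray_le_of_le τ h2 ha'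
  · set N := wordDist (proj n d a₀) ω
    -- With this delay, `proj c` is at distance at most `l - t₀ - k + N ≤ l - t` from `ω`.
    obtain ⟨k, hk⟩ := exists_nat_ge (N + t - t₀)
    obtain ⟨l, c, hl, hc, hle⟩ := exists_vertex_wordDist_proj_add_le o hinf h₀ k
    have h1 := wordDist_triangle (proj n d c) (proj n d a₀) ω
    rw [wordDist_comm (proj n d c) (proj n d a₀)] at h1
    have h2 := wordDist_nonneg (proj n d c) ω
    -- From `c`, follow the letters of `C` that lead from `proj c` to `ω`; the inclusion does not
    -- lengthen this walk.
    refine ⟨c * incl n d ((proj n d c)⁻¹ * ω), ⟨l, by linarith, ?_⟩, ?_⟩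
    · rw [hc, dist_vertex_vertex, wordDist_comm]
      have h3 := wordDist_mul_left c 1 (incl n d ((proj n d c)⁻¹ * ω))
      have h4 := wordDist_incl_le (d := d) 1 ((proj n d c)⁻¹ * ω)
      have h5 := wordDist_mul_left (proj n d c) 1 ((proj n d c)⁻¹ * ω)
      rw [mul_one] at h3
      rw [mul_one, mul_inv_cancel_left] at h5
      rw [map_one] at h4
      linarith
    · rw [map_mul, proj_incl, mul_inv_cancel_left]

end CayleyGraph
end SigmaInv

theorem mainTheorem7 {K : Type u} [Group K] [Group.FG K] [Nontrivial K] (n d : ℕ) (hn : 0 < n)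
    (τ : SigmaInv.GeodesicRay (SigmaInv.CayleyTree (Fin n ⊕ Fin d))) :
    τ.endpoint ∈ SigmaInv.Sigma1 (SigmaInv.rho K n d) ↔
      {t : ℝ≥0 | SigmaInv.ReadsLetterFromD τ t}.Infinite := by
  constructor
  · rintro ⟨τ', Γ, h, hend, hΓ, hh, hcc⟩
    obtain ⟨R, hR⟩ := Quotient.exact hend
    exact SigmaInv.infinite_of_controlledConnected (Sum.inl ⟨0, hn⟩) hR hΓ hh hcc
  · exact SigmaInv.endpoint_mem_sigma1 (Sum.inl ⟨0, hn⟩)
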